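/- **Terms.** An infinite $\lambda$-term is a closed, finite or infinite, term built from variables, abstractions $\lambda x.M$ and applications $M\,N$, taken modulo $\alpha$-conversion. A prefixed term $(\lambda x_1\ldots x_n)M$ consists of an abstraction prefix $x_1\ldots x_n$ (of length $n\ge 0$) and a finite or infinite $\lambda$-term $M$ all of whose free variables are among $x_1,\dots,x_n$, again modulo $\alpha$-conversion; $()M$ denotes $M$ with empty prefix. The prefix binding $\lambda x_i$ is vacuous if $x_i$ does not occur free in $M$. **Decomposition systems.** $\mathit{Reg}$ and $\mathit{Reg}^+$ are the rewrite systems on prefixed terms with the (root) steps $(\lambda\vec x)(M_0M_1)\to_{@_0}(\lambda\vec x)M_0$, $\;(\lambda\vec x)(M_0M_1)\to_{@_1}(\lambda\vec x)M_1$, $\;(\lambda\vec x)\lambda y.M\to_{\lambda}(\lambda\vec x y)M$, and the vacuous-binding steps: in $\mathit{Reg}$, $(\lambda x_1\ldots x_n)M\to(\lambda x_1\ldots x_{i-1}x_{i+1}\ldots x_n)M$ for any vacuous $\lambda x_i$; in $\mathit{Reg}^+$, $(\lambda x_1\ldots x_n)M\to(\lambda x_1\ldots x_{n-1})M$ if $\lambda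 x_n$ is vacuous. A (possibly history-aware) strategy is a sub-rewrite-system with the same normal forms, where the terms may additionally carry labels recording information about the rewriting history (with a given initial labelling of the unlabelled terms). It is called scope-delimiting (for $\mathit{Reg}$), respectively scope$^+$-delimiting (for $\mathit{Reg}^+$), if each (labelled) term is the source of at most one step of the strategy, except that for an application the strategy may offer exactly one $\to_{@_0}$- and exactly one $\to_{@_1}$-step; these two kinds of steps are always offered together. An infinite $\lambda$-term $M$ is *regular* (*strongly regular*) if there is a scope-delimiting strategy for $\mathit{Reg}$ (a scope$^+$-delimiting strategy for $\mathit{Reg}^+$) such that only finitely many prefixed terms are reachable from $()M$ by steps of the strategy. **Proof systems.** Derivations are finite natural-deduction prooftrees of prefixed terms, whose leaves are axioms or marked assumptions $((\lambda\vec x)M)^u$. $\mathbf{Reg}^+$ has the axioms $(\lambda\vec x y)y$ and the rules $$\frac{(\lambda\vec x y)M}{(\lambda\vec x)\lambda y.M}\ (\lambda)\qquad \frac{(\lambda\vec x)M_0\quad(\lambda\vec x)M_1}{(\lambda\vec x)M_0M_1}\ (@)\qquad \frac{(\lambda x_1\ldots x_{n-1})M}{(\lambda x_1\ldots x_n)M}\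 (\text{if }\lambda x_n\text{ is vacuous})$$ together with the rule $(\mathrm{FIX},u)$: from a derivation $\mathcal D_0$ of $(\lambda\vec x)M$, possibly using open marked assumptions $((\lambda\vec x)M)^u$, conclude $(\lambda\vec x)M$ and discharge these assumptions, provided that $\mathcal D_0$ has depth at least $1$ (a single leaf, axiom or assumption, has depth $0$). $\mathbf{Reg}^+_0$ is $\mathbf{Reg}^+$ with the additional side-condition on $(\mathrm{FIX},u)$ that $|\vec y|\ge|\vec x|$ for every $(\lambda\vec y)N$ on the threads in $\mathcal D_0$ from the open assumptions $((\lambda\vec x)M)^u$ downwards. $\mathbf{Reg}$ arises from $\mathbf{Reg}^+$ by restricting the axioms to $(\lambda y)y$ and by replacing the vacuous-binding rule by $$\frac{(\lambda x_1\ldots x_{i-1}x_{i+1}\ldots x_n)M}{(\lambda x_1\ldots x_n)M}\ (\text{if }\lambda x_i\text{ is vacuous}).$$ For each of these systems $\mathbf R$, $\vdash_{\mathbf R}(\lambda\vec x)M$ means that there is a derivation in $\mathbf R$ with conclusion $(\lambda\vec x)M$ in which all marked assumptions are discharged. **Theorem.** (i) For every infinite $\lambda$-term $M$: $\;\vdash_{\mathbf{Reg}}()M$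 if and only if $M$ is regular. (ii) For every infinite $\lambda$-term $M$ the following are equivalent: (a) $M$ is strongly regular; (b) $\vdash_{\mathbf{Reg}^+}()M$; (c) $\vdash_{\mathbf{Reg}^+_0}()M$. -/

import Mathlib

namespace InfLambda

/-! ### Infinite lambda-terms

Terms modulo alpha-conversion are represented by (possibly infinite) trees with de Bruijn indices. -/

/-- Node labels: a variable (de Bruijn index), an abstraction, an application. -/
inductive Node : Type
  | var (i : ℕ)
  | lam
  | app

/-- The polynomial functor `X ↦ ℕ + X + X × X`. -/
def termFunctor : PFunctor.{0, 0} where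
  A := Node
  B
    | .var _ => Empty
    | .lam => Unit
    | .app => Bool

/-- Finite or infinite lambda-terms, possibly with free variables: the final coalgebra of
`termFunctor`. -/
def Term : Type := termFunctor.M

namespace Term

def var (i : ℕ) : Term := PFunctor.M.mk (F := termFunctor) ⟨Node.var i, Empty.elim⟩

def lam (M : Term) : Term := PFunctor.M.mk (F := termFunctor) ⟨Node.lam, fun _ => M⟩

def app (M N : Term) : Term :=
  PFunctor.M.mk (F := termFunctor) ⟨Node.app, fun b => bif b then N else M⟩

/-- `Occurs i M`: the variable with index `i` (counted from outside `M`) occurs free in `M`. -/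
inductive Occurs : ℕ → Term → Prop
  | var (i : ℕ) : Occurs i (var i)
  | lam {i : ℕ} {M : Term} : Occurs (i + 1) M → Occurs i (lam M)
  | appLeft {i : ℕ} {M N : Term} : Occurs i M → Occurs i (app M N)
  | appRight {i : ℕ} {M N : Term} : Occurs i N → Occurs i (app M N)

/-- One layer of `lower`. -/
def lowerLayer (k : ℕ) : termFunctor Term → termFunctor (ℕ × Term)
  | ⟨.var i, _⟩ => ⟨Node.var (if k < i then i - 1 else i), Empty.elim⟩
  | ⟨.lam, f⟩ => ⟨Node.lam, fun _ => (k + 1, f ())⟩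
  | ⟨.app, f⟩ => ⟨Node.app, fun b => (k, f b)⟩

/-- `lower k M`: all free indices of `M` above `k` are decremented. If the variable `k` does not
occur in `M`, this is the same term `M`, read in the context in which the unused variable `k` has
been dropped. -/
def lower (k : ℕ) (M : Term) : Term :=
  PFunctor.M.corec (F := termFunctor) (fun s => lowerLayer s.1 (PFunctor.M.dest s.2)) (k, M)

theorem lower_mk (k : ℕ) (x : termFunctor Term) :
    lower k (PFunctor.M.mk (F := termFunctor) x) =
      PFunctor.M.mk (F := termFunctor)
        (termFunctor.map (fun s : ℕ × Term => lower s.1 s.2) (lowerLayer k x)) :=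
  (PFunctor.M.corec_def (F := termFunctor) _ _).trans
    (congrArg (fun y => PFunctor.M.mk (F := termFunctor)
      (termFunctor.map (fun s : ℕ × Term => lower s.1 s.2) (lowerLayer k y)))
      (PFunctor.M.dest_mk (F := termFunctor) x))

theorem lower_var (k i : ℕ) : lower k (var i) = var (if k < i then i - 1 else i) :=
  (lower_mk k _).trans (congrArg
    (fun f : Empty → Term =>
      PFunctor.M.mk (F := termFunctor) ⟨Node.var (if k < i then i - 1 else i), f⟩)
    (funext fun b => b.elim))

theorem lower_lam (k : ℕ) (M : Term) : lower k (lam M) = lam (lower (k + 1) M) :=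
  lower_mk k _

theorem lower_app (k : ℕ) (M N : Term) : lower k (app M N) = app (lower k M) (lower k N) :=
  (lower_mk k _).trans (congrArg
    (fun f : Bool → Term => PFunctor.M.mk (F := termFunctor) ⟨Node.app, f⟩)
    (funext fun b => by cases b <;> rfl))

end Term

/-- (Possibly) infinite lambda-terms: the closed ones. -/
structure InfTerm : Type where
  term : Term
  closed : ∀ i, ¬ term.Occurs i

/-- Prefixed terms `(λ x₁ … xₙ) M` in which all free variables of `M` are among `x₁, …, xₙ`;
`len = n` is the length of the abstraction prefix, and the index `k` in `body` stands for
`xₙ₋ₖ` (so index `0` is the last variable of the prefix). -/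
@[ext]
structure PTerm : Type where
  len : ℕ
  body : Term
  bound : ∀ i, body.Occurs i → i < len

/-- The term `() M` with empty abstraction prefix. -/
def InfTerm.emptyPrefix (M : InfTerm) : PTerm where
  len := 0
  body := M.term
  bound i h := absurd h (M.closed i)

/-! ### Decomposition of prefixed terms -/

/-- `T = (λ x₁ … xₙ) λ y. M` and `T' = (λ x₁ … xₙ y) M`. -/
def LamDecomp (T T' : PTerm) : Prop :=
  T.body = Term.lam T'.body ∧ T'.len = T.len + 1

/-- `T = (λ x₁ … xₙ) (M₀ M₁)`, `T₀ = (λ x₁ … xₙ) M₀` and `T₁ = (λ x₁ … xₙ) M₁`. -/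
def AppDecomp (T T₀ T₁ : PTerm) : Prop :=
  T.body = Term.app T₀.body T₁.body ∧ T₀.len = T.len ∧ T₁.len = T.len

/-- The variable with index `k` of the prefix of `T` is vacuous (it does not occur in the body of
`T`), and `T'` arises from `T` by removing it from the prefix. -/
def VacAt (k : ℕ) (T T' : PTerm) : Prop :=
  k < T.len ∧ ¬ T.body.Occurs k ∧ T.len = T'.len + 1 ∧ T'.body = T.body.lower k

/-- Removal of an arbitrary vacuous binding of the prefix. -/
def VacAny (T T' : PTerm) : Prop := ∃ k, VacAt k T T'

/-- Removal of the last binding of the prefix, if it is vacuous. -/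
def VacLast (T T' : PTerm) : Prop := VacAt 0 T T'

/-! ### The decomposition rewrite systems, strategies, regularity -/

inductive StepKind : Type
  | app₀
  | app₁
  | lam
  | vac

/-- Steps of the rewrite system on prefixed terms whose steps of kind `vac` are given by `V`. -/
def DecompStep (V : PTerm → PTerm → Prop) : StepKind → PTerm → PTerm → Prop
  | .app₀, T, T' => ∃ T₁, AppDecomp T T' T₁
  | .app₁, T, T' => ∃ T₀, AppDecomp T T₀ T'
  | .lam, T, T' => LamDecomp T T'
  | .vac, T, T' => V T T'

/-- The rewrite system `Reg`. -/
def RegStep : StepKind → PTerm → PTerm → Prop := DecompStep VacAny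

/-- The rewrite system `Reg⁺`. -/
def RegPlusStep : StepKind → PTerm → PTerm → Prop := DecompStep VacLast

/-- A (history-aware) strategy for the rewrite system `R` on prefixed terms: a subsystem, with the
same normal forms, of a version of `R` in which the terms carry labels that record information
about the history, together with an initial labelling. With only one label, this is a history-free
strategy: a subsystem of `R` with the same normal forms. -/
structure Strategy (R : StepKind → PTerm → PTerm → Prop) : Type 1 where
  Label : Type
  init : PTerm → Label
  step : StepKind → Label × PTerm → Label × PTerm → Prop
  step_sub : ∀ κ s s', step κ s s' → R κ s.2 s'.2
  normalForm : ∀ s, (∀ κ s', ¬ step κ s s') → ∀ κ T', ¬ R κ s.2 T'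

namespace Strategy

variable {R : StepKind → PTerm → PTerm → Prop}

/-- (Extended) scope-delimiting strategies: the only non-determinism is the one between the two
decomposition steps of an application, and these two steps are always offered together. -/
structure IsScopeDelimiting (S : Strategy R) : Prop where
  deterministic : ∀ κ κ' s s₁ s₂, S.step κ s s₁ → S.step κ' s s₂ →
    (κ = κ' ∧ s₁ = s₂) ∨ (κ = .app₀ ∧ κ' = .app₁) ∨ (κ = .app₁ ∧ κ' = .app₀)
  both : ∀ s, (∃ s₀, S.step .app₀ s s₀) ↔ (∃ s₁, S.step .app₁ s s₁)

/-- The set of `S`-generated subterms of `M`: the prefixed terms that are reachable from `() M` by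
steps according to `S`. -/
def generatedSubterms (S : Strategy R) (M : InfTerm) : Set PTerm :=
  {T | ∃ l, Relation.ReflTransGen (fun s s' => ∃ κ, S.step κ s s')
    (S.init M.emptyPrefix, M.emptyPrefix) (l, T)}

end Strategy

def Regular (M : InfTerm) : Prop :=
  ∃ S : Strategy RegStep, S.IsScopeDelimiting ∧ (S.generatedSubterms M).Finite

def StronglyRegular (M : InfTerm) : Prop :=
  ∃ S : Strategy RegPlusStep, S.IsScopeDelimiting ∧ (S.generatedSubterms M).Finite

/-! ### The proof systems -/

inductive ProofSystem : Type
  | reg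
  | regPlus
  | regPlusZero

/-- Finite prooftrees. Each constructor but `fix` carries the conclusion of its instance; the
conclusion of an instance of `fix` equals its premise. Assumptions carry markers. -/
inductive ProofTree : Type
  | assumption (u : ℕ) (T : PTerm)
  | nlvar (T : PTerm)
  | lam (T : PTerm) (D : ProofTree)
  | app (T : PTerm) (D₀ D₁ : ProofTree)
  | vac (T : PTerm) (D : ProofTree)
  | fix (u : ℕ) (D : ProofTree)

namespace ProofTree

def conclusion : ProofTree → PTerm
  | assumption _ T => T
  | nlvar T => T
  | lam T _ => T
  | app T _ _ => T
  | vac T _ => T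
  | fix _ D => D.conclusion

/-- The depth of a prooftree; one that consists only of a leaf has depth `0`. -/
def depth : ProofTree → ℕ
  | assumption _ _ => 0
  | nlvar _ => 0
  | lam _ D => D.depth + 1
  | app _ D₀ D₁ => max D₀.depth D₁.depth + 1
  | vac _ D => D.depth + 1
  | fix _ D => D.depth + 1

/-- `Thread u A D t`: `t` lists the formula occurrences on the path in `D` from an occurrence of
the marked assumption `A` with marker `u` that is open in `D` (not discharged in `D`) down to the
conclusion of `D`, the conclusion of `D` coming first. An instance `fix v` discharges the open
assumptions in its immediate subderivation that have marker `v` and whose formula is its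
conclusion. -/
inductive Thread (u : ℕ) (A : PTerm) : ProofTree → List PTerm → Prop
  | assumption : Thread u A (assumption u A) [A]
  | lam {T D t} : Thread u A D t → Thread u A (lam T D) (T :: t)
  | appLeft {T D₀ D₁ t} : Thread u A D₀ t → Thread u A (app T D₀ D₁) (T :: t)
  | appRight {T D₀ D₁ t} : Thread u A D₁ t → Thread u A (app T D₀ D₁) (T :: t)
  | vac {T D t} : Thread u A D t → Thread u A (vac T D) (T :: t)
  | fix {v D t} : Thread u A D t → ¬ (u = v ∧ A = D.conclusion) →
      Thread u A (fix v D) (D.conclusion :: t)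

/-- All marked assumptions are discharged. -/
def IsClosed (D : ProofTree) : Prop := ∀ u A t, ¬ D.Thread u A t

end ProofTree

namespace ProofSystem

/-- The axioms: `(λ y) y` in `Reg`, and `(λ x₁ … xₙ y) y` in `Reg⁺` and `Reg⁺₀`. -/
def IsAxiomInstance : ProofSystem → PTerm → Prop
  | reg, T => T.len = 1 ∧ T.body = Term.var 0
  | regPlus, T => 1 ≤ T.len ∧ T.body = Term.var 0
  | regPlusZero, T => 1 ≤ T.len ∧ T.body = Term.var 0

/-- The rule for vacuous bindings (conclusion first, then premise). -/
def Vac : ProofSystem → PTerm → PTerm → Prop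
  | reg => VacAny
  | regPlus => VacLast
  | regPlusZero => VacLast

/-- The side-condition on an instance of the rule `FIX` with marker `u` and immediate subderivation
`D`: the depth of `D` is at least `1`; and in `Reg⁺₀`, in addition, all prefixed terms on threads
in `D` from open assumptions that are discharged at this instance downwards have prefixes at least
as long as that of the conclusion. -/
def FixCondition : ProofSystem → ℕ → ProofTree → Prop
  | reg, _, D => 1 ≤ D.depth
  | regPlus, _, D => 1 ≤ D.depth
  | regPlusZero, u, D => 1 ≤ D.depth ∧
      ∀ t, D.Thread u D.conclusion t → ∀ T ∈ t, D.conclusion.len ≤ T.len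

/-- Derivations of a proof system, possibly with open assumptions. -/
inductive IsDerivation (P : ProofSystem) : ProofTree → Prop
  | assumption (u : ℕ) (T : PTerm) : IsDerivation P (.assumption u T)
  | nlvar {T : PTerm} : P.IsAxiomInstance T → IsDerivation P (.nlvar T)
  | lam {T : PTerm} {D : ProofTree} : LamDecomp T D.conclusion →
      IsDerivation P D → IsDerivation P (.lam T D)
  | app {T : PTerm} {D₀ D₁ : ProofTree} : AppDecomp T D₀.conclusion D₁.conclusion →
      IsDerivation P D₀ → IsDerivation P D₁ → IsDerivation P (.app T D₀ D₁)
  | vac {T : PTerm} {D : ProofTree} : P.Vac T D.conclusion →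
      IsDerivation P D → IsDerivation P (.vac T D)
  | fix {u : ℕ} {D : ProofTree} : P.FixCondition u D →
      IsDerivation P D → IsDerivation P (.fix u D)

/-- Provability: existence of a closed derivation. -/
def Provable (P : ProofSystem) (T : PTerm) : Prop :=
  ∃ D : ProofTree, P.IsDerivation D ∧ D.IsClosed ∧ D.conclusion = T

end ProofSystem

end InfLambda

/-!
All five notions are compared with one combinatorial condition. Call a set `F` of prefixed terms
*unfolding closed* for a proof system if each member of `F` is an axiom or the conclusion of a rule
instance, other than an instance of `FIX`, whose premises lie in `F`. Rule instances read upwards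
are exactly decomposition steps, and axioms are exactly the normal forms of these steps.

* A term is (strongly) regular if and only if it lies in a finite unfolding closed set: the
  generated subterms of a scope-delimiting strategy form such a set
  (`exists_finite_unfoldingClosed_of_strategy`), and conversely choosing one rule instance for each
  prefixed term, inside `F` where possible, gives a history-free strategy that does not leave `F`
  (`exists_strategy_of_unfoldingClosed`).
* A term is provable if and only if it lies in a finite unfolding closed set. The formulas of a
  closed derivation form such a set: a discharged assumption recurs as the conclusion of an instance
  of `FIX`, and, the premise of that instance being no leaf, also as the conclusion of another rule
  (`IsDerivation.exists_finite_unfolds`). Conversely, `F` is unfolded into a derivation, starting at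
  the conclusion. A branch is closed by an assumption as soon as it reaches a formula that it has
  already visited without passing through a shorter prefix in between, so that the side-condition
  of `Reg⁺₀` on threads holds by construction. This process terminates, because visiting `T` removes
  `T` from the set of formulas that are not yet available as assumptions, and restores to this set
  only formulas with longer prefixes; with finitely many formulas this is a descent in the
  Dershowitz–Manna order (`exists_derivation_of_unfoldingClosed`).

The systems `Reg⁺` and `Reg⁺₀` have the same axioms and the same rules other than `FIX`, and hence
the same unfolding closed sets.
-/

namespace InfLambda

/-! ### Constructors of infinite terms -/

namespace Term

theorem exists_eq_var_or_lam_or_app (M : Term) :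
    (∃ i, M = var i) ∨ (∃ N, M = lam N) ∨ ∃ N₀ N₁, M = app N₀ N₁ := by
  obtain ⟨⟨a, f⟩, rfl⟩ : ∃ x, M = PFunctor.M.mk (F := termFunctor) x :=
    ⟨_, (PFunctor.M.mk_dest (F := termFunctor) M).symm⟩
  cases a with
  | var i =>
    refine Or.inl ⟨i, ?_⟩
    have h : f = Empty.elim := funext fun b => b.elim
    rw [h]
    rfl
  | lam => exact Or.inr (Or.inl ⟨f (), rfl⟩)
  | app =>
    refine Or.inr (Or.inr ⟨f false, f true, ?_⟩)
    have h : f = fun b => bif b then f true else f false := funext fun b => by cases b <;> rfl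
    exact congrArg
      (fun g : Bool → Term => PFunctor.M.mk (F := termFunctor) ⟨Node.app, g⟩) h

/-- The label of the root. -/
def root (M : Term) : Node := (PFunctor.M.dest (F := termFunctor) M).1

theorem root_var (i : ℕ) : (var i).root = Node.var i := rfl

theorem root_lam (M : Term) : (lam M).root = Node.lam := rfl

theorem root_app (M N : Term) : (app M N).root = Node.app := rfl

theorem var_injective : Function.Injective var := fun i j h => by
  have h' := congrArg root h
  rw [root_var, root_var] at h'
  exact Node.var.inj h'

theorem var_ne_lam (i : ℕ) (M : Term) : var i ≠ lam M := fun h => by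
  have h' := congrArg root h
  rw [root_var, root_lam] at h'
  cases h'

theorem var_ne_app (i : ℕ) (M N : Term) : var i ≠ app M N := fun h => by
  have h' := congrArg root h
  rw [root_var, root_app] at h'
  cases h'

theorem app_injective {M N M' N' : Term} (h : app M N = app M' N') : M = M' ∧ N = N' := by
  have h' := PFunctor.M.mk_inj (F := termFunctor) h
  have h'' : (fun b => bif b then N else M) = fun b => bif b then N' else M' :=
    eq_of_heq (Sigma.mk.inj h').2
  exact ⟨congrFun h'' false, congrFun h'' true⟩

theorem occurs_var_iff {i j : ℕ} : (var i).Occurs j ↔ j = i := by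
  refine ⟨fun h => ?_, fun h => h ▸ Occurs.var j⟩
  generalize hM : var i = M at h
  cases h with
  | var => exact (var_injective hM).symm
  | lam => exact absurd hM (var_ne_lam _ _)
  | appLeft => exact absurd hM (var_ne_app _ _ _)
  | appRight => exact absurd hM (var_ne_app _ _ _)

end Term

/-! ### Axioms and normal forms -/

theorem PTerm.exists_lamDecomp {T : PTerm} {M : Term} (h : T.body = Term.lam M) :
    ∃ T', LamDecomp T T' := by
  refine ⟨⟨T.len + 1, M, fun i hi => ?_⟩, h, rfl⟩
  cases i with
  | zero => exact Nat.succ_pos _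
  | succ i => exact Nat.succ_lt_succ (T.bound i (h ▸ Term.Occurs.lam hi))

theorem PTerm.exists_appDecomp {T : PTerm} {M N : Term} (h : T.body = Term.app M N) :
    ∃ T₀ T₁, AppDecomp T T₀ T₁ :=
  ⟨⟨T.len, M, fun i hi => T.bound i (h ▸ Term.Occurs.appLeft hi)⟩,
    ⟨T.len, N, fun i hi => T.bound i (h ▸ Term.Occurs.appRight hi)⟩, h, rfl, rfl⟩

theorem PTerm.exists_vacAt {T : PTerm} {i k : ℕ} (h : T.body = Term.var i) (hk : k < T.len)
    (hne : k ≠ i) : ∃ T', VacAt k T T' := by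
  have hi : i < T.len := T.bound i (h ▸ Term.Occurs.var i)
  refine ⟨⟨T.len - 1, T.body.lower k, fun j hj => ?_⟩, hk, ?_, ?_, rfl⟩
  · rw [h, Term.lower_var, Term.occurs_var_iff] at hj
    split at hj <;> omega
  · rw [h, Term.occurs_var_iff]
    exact hne
  · change T.len = T.len - 1 + 1
    omega

theorem AppDecomp.of_left_of_right {T T₀ T₁ S₀ S₁ : PTerm} (h₀ : AppDecomp T T₀ S₁)
    (h₁ : AppDecomp T S₀ T₁) : AppDecomp T T₀ T₁ := by
  obtain ⟨-, h⟩ := Term.app_injective (h₀.1.symm.trans h₁.1)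
  exact ⟨by rw [← h, h₀.1], h₀.2.1, h₁.2.2⟩

namespace ProofSystem

/-- The axioms of a proof system are the normal forms of its rules, read as decomposition steps. -/
theorem isAxiomInstance_iff_normalForm (P : ProofSystem) (T : PTerm) :
    P.IsAxiomInstance T ↔ ∀ κ T', ¬ DecompStep P.Vac κ T T' := by
  constructor
  · intro h κ T' hs
    have hb : T.body = Term.var 0 := by cases P <;> exact h.2
    have h0 : T.body.Occurs 0 := hb ▸ Term.Occurs.var 0
    cases κ with
    | app₀ => exact Term.var_ne_app _ _ _ (hb.symm.trans hs.choose_spec.1)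
    | app₁ => exact Term.var_ne_app _ _ _ (hb.symm.trans hs.choose_spec.1)
    | lam => exact Term.var_ne_lam _ _ (hb.symm.trans hs.1)
    | vac =>
      cases P with
      | reg =>
        obtain ⟨k, hk, hv, -⟩ := hs
        obtain rfl : k = 0 := by have := h.1; omega
        exact hv h0
      | regPlus => exact hs.2.1 h0
      | regPlusZero => exact hs.2.1 h0
  · intro h
    obtain ⟨i, hi⟩ | ⟨M, hM⟩ | ⟨M, N, hMN⟩ := T.body.exists_eq_var_or_lam_or_app
    · have hlt : i < T.len := T.bound i (hi ▸ Term.Occurs.var i)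
      have hzero (hv : ∀ T', ¬ VacAt 0 T T') : i = 0 := by
        by_contra hne
        obtain ⟨T', hT'⟩ := PTerm.exists_vacAt hi (by omega) (Ne.symm hne)
        exact hv T' hT'
      cases P with
      | reg =>
        obtain rfl := hzero fun T' hT' => h .vac T' ⟨0, hT'⟩
        refine ⟨?_, hi⟩
        by_contra hne
        obtain ⟨T', hT'⟩ := PTerm.exists_vacAt (k := 1) hi (by omega) one_ne_zero
        exact h .vac T' ⟨1, hT'⟩
      | regPlus =>
        obtain rfl := hzero fun T' hT' => h .vac T' hT'
        exact ⟨hlt, hi⟩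
      | regPlusZero =>
        obtain rfl := hzero fun T' hT' => h .vac T' hT'
        exact ⟨hlt, hi⟩
    · obtain ⟨T', hT'⟩ := PTerm.exists_lamDecomp hM
      exact absurd hT' (h .lam T')
    · obtain ⟨T₀, T₁, hT⟩ := PTerm.exists_appDecomp hMN
      exact absurd ⟨T₁, hT⟩ (h .app₀ T₀)

/-! ### Unfolding closed sets -/

/-- `P.Unfolds F T`: the prefixed term `T` is an axiom of `P`, or the conclusion of an instance of a
rule of `P` other than `FIX` with all premises in `F`. -/
inductive Unfolds (P : ProofSystem) (F : Set PTerm) (T : PTerm) : Prop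
  | nlvar : P.IsAxiomInstance T → Unfolds P F T
  | lam {T'} : T' ∈ F → LamDecomp T T' → Unfolds P F T
  | app {T₀ T₁} : T₀ ∈ F → T₁ ∈ F → AppDecomp T T₀ T₁ → Unfolds P F T
  | vac {T'} : T' ∈ F → P.Vac T T' → Unfolds P F T

/-- A set of prefixed terms each of which unfolds within the set. -/
def UnfoldingClosed (P : ProofSystem) (F : Set PTerm) : Prop := ∀ T ∈ F, P.Unfolds F T

theorem Unfolds.mono {P : ProofSystem} {F G : Set PTerm} {T : PTerm} (hFG : F ⊆ G)
    (h : P.Unfolds F T) : P.Unfolds G T := by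
  cases h with
  | nlvar h => exact .nlvar h
  | lam hT' h => exact .lam (hFG hT') h
  | app hT₀ hT₁ h => exact .app (hFG hT₀) (hFG hT₁) h
  | vac hT' h => exact .vac (hFG hT') h

theorem unfolds_univ (P : ProofSystem) (T : PTerm) : P.Unfolds Set.univ T := by
  by_cases h : ∀ κ T', ¬ DecompStep P.Vac κ T T'
  · exact .nlvar ((P.isAxiomInstance_iff_normalForm T).2 h)
  · push Not at h
    obtain ⟨κ, T', h⟩ := h
    cases κ with
    | app₀ => exact .app trivial trivial h.choose_spec
    | app₁ => exact .app trivial trivial h.choose_spec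
    | lam => exact .lam trivial h
    | vac => exact .vac trivial h

/-! ### Unfolding closed sets and strategies -/

/-- The subterms generated by a scope-delimiting strategy form an unfolding closed set. -/
theorem exists_finite_unfoldingClosed_of_strategy {P : ProofSystem} {M : InfTerm}
    (S : Strategy (DecompStep P.Vac)) (hS : S.IsScopeDelimiting)
    (hfin : (S.generatedSubterms M).Finite) :
    ∃ F : Set PTerm, F.Finite ∧ M.emptyPrefix ∈ F ∧ P.UnfoldingClosed F := by
  refine ⟨S.generatedSubterms M, hfin, ⟨_, .refl⟩, ?_⟩
  rintro T ⟨l, hl⟩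
  have hmem {κ s'} (h : S.step κ (l, T) s') : s'.2 ∈ S.generatedSubterms M :=
    ⟨s'.1, hl.tail ⟨κ, h⟩⟩
  have happ {s₀ s₁} (h₀ : S.step .app₀ (l, T) s₀) (h₁ : S.step .app₁ (l, T) s₁) :
      P.Unfolds (S.generatedSubterms M) T := by
    obtain ⟨_, h₀'⟩ := S.step_sub _ _ _ h₀
    obtain ⟨_, h₁'⟩ := S.step_sub _ _ _ h₁
    exact .app (hmem h₀) (hmem h₁) (h₀'.of_left_of_right h₁')
  by_cases hn : ∀ κ s', ¬ S.step κ (l, T) s'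
  · exact .nlvar ((P.isAxiomInstance_iff_normalForm T).2 (S.normalForm _ hn))
  · push Not at hn
    obtain ⟨κ, s', h⟩ := hn
    cases κ with
    | app₀ =>
      obtain ⟨s₁, h₁⟩ := (hS.both _).1 ⟨s', h⟩
      exact happ h h₁
    | app₁ =>
      obtain ⟨s₀, h₀⟩ := (hS.both _).2 ⟨s', h⟩
      exact happ h₀ h
    | lam => exact .lam (hmem h) (S.step_sub _ _ _ h)
    | vac => exact .vac (hmem h) (S.step_sub _ _ _ h)

/-- `IsLocalStrategy P F T σ`: the relation `σ` selects steps from `T` to members of `F` that obey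
the conditions on scope-delimiting strategies at `T`. -/
structure IsLocalStrategy (P : ProofSystem) (F : Set PTerm) (T : PTerm)
    (σ : StepKind → PTerm → Prop) : Prop where
  step_sub : ∀ κ T', σ κ T' → DecompStep P.Vac κ T T'
  mem : ∀ κ T', σ κ T' → T' ∈ F
  normalForm : (∀ κ T', ¬ σ κ T') → ∀ κ T', ¬ DecompStep P.Vac κ T T'
  deterministic : ∀ κ κ' T₁ T₂, σ κ T₁ → σ κ' T₂ →
    (κ = κ' ∧ T₁ = T₂) ∨ (κ = .app₀ ∧ κ' = .app₁) ∨ (κ = .app₁ ∧ κ' = .app₀)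
  both : (∃ T₀, σ .app₀ T₀) ↔ ∃ T₁, σ .app₁ T₁

theorem isLocalStrategy_single {P : ProofSystem} {F : Set PTerm} {T T' : PTerm} {κ : StepKind}
    (h : DecompStep P.Vac κ T T') (hT' : T' ∈ F) (h₀ : κ ≠ .app₀) (h₁ : κ ≠ .app₁) :
    P.IsLocalStrategy F T fun κ' S => κ' = κ ∧ S = T' where
  step_sub := by
    rintro _ _ ⟨rfl, rfl⟩
    exact h
  mem := by
    rintro _ _ ⟨-, rfl⟩
    exact hT'
  normalForm hn := absurd ⟨rfl, rfl⟩ (hn κ T')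
  deterministic := by
    rintro _ _ _ _ ⟨rfl, rfl⟩ ⟨rfl, rfl⟩
    exact Or.inl ⟨rfl, rfl⟩
  both := ⟨fun ⟨_, h, _⟩ => absurd h.symm h₀, fun ⟨_, h, _⟩ => absurd h.symm h₁⟩

theorem Unfolds.exists_isLocalStrategy {P : ProofSystem} {F : Set PTerm} {T : PTerm}
    (h : P.Unfolds F T) : ∃ σ, P.IsLocalStrategy F T σ := by
  cases h with
  | nlvar h =>
    exact ⟨fun _ _ => False, fun _ _ => False.elim, fun _ _ => False.elim,
      fun _ => (P.isAxiomInstance_iff_normalForm T).1 h, fun _ _ _ _ => False.elim,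
      ⟨fun ⟨_, h⟩ => h.elim, fun ⟨_, h⟩ => h.elim⟩⟩
  | lam hT' h => exact ⟨_, isLocalStrategy_single (κ := .lam) h hT' nofun nofun⟩
  | vac hT' h => exact ⟨_, isLocalStrategy_single (κ := .vac) h hT' nofun nofun⟩
  | @app T₀ T₁ hT₀ hT₁ h =>
    refine ⟨fun κ S => (κ = .app₀ ∧ S = T₀) ∨ (κ = .app₁ ∧ S = T₁), ?_, ?_, ?_, ?_, ?_⟩
    · rintro _ _ (⟨rfl, rfl⟩ | ⟨rfl, rfl⟩)
      exacts [⟨_, h⟩, ⟨_, h⟩]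
    · rintro _ _ (⟨-, rfl⟩ | ⟨-, rfl⟩)
      exacts [hT₀, hT₁]
    · exact fun hn => absurd (Or.inl ⟨rfl, rfl⟩) (hn .app₀ T₀)
    · rintro _ _ _ _ (⟨rfl, rfl⟩ | ⟨rfl, rfl⟩) (⟨rfl, rfl⟩ | ⟨rfl, rfl⟩) <;> simp
    · exact ⟨fun _ => ⟨T₁, Or.inr ⟨rfl, rfl⟩⟩, fun _ => ⟨T₀, Or.inl ⟨rfl, rfl⟩⟩⟩

/-- A choice of one unfolding for each prefixed term, inside `F` for the members of `F`, is a
history-free scope-delimiting strategy that never leaves `F`. -/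
theorem exists_strategy_of_unfoldingClosed {P : ProofSystem} {F : Set PTerm} {M : InfTerm}
    (hF : P.UnfoldingClosed F) (hM : M.emptyPrefix ∈ F) :
    ∃ S : Strategy (DecompStep P.Vac), S.IsScopeDelimiting ∧ S.generatedSubterms M ⊆ F := by
  have hex (T : PTerm) : ∃ σ, P.IsLocalStrategy {T' | T ∈ F → T' ∈ F} T σ := by
    refine Unfolds.exists_isLocalStrategy ?_
    by_cases hT : T ∈ F
    · exact (hF T hT).mono fun _ h _ => h
    · exact (P.unfolds_univ T).mono fun _ _ h => absurd h hT
  choose σ hσ using hex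
  refine ⟨⟨Unit, fun _ => (), fun κ s s' => σ s.2 κ s'.2, fun κ s s' => (hσ s.2).step_sub κ s'.2,
    fun s hs => (hσ s.2).normalForm fun κ T' => hs κ ((), T')⟩, ⟨?_, ?_⟩, ?_⟩
  · intro κ κ' s s₁ s₂ h₁ h₂
    exact ((hσ s.2).deterministic _ _ _ _ h₁ h₂).imp_left fun h => ⟨h.1, Prod.ext rfl h.2⟩
  · intro s
    exact ⟨fun ⟨s₀, h₀⟩ => ((hσ s.2).both.1 ⟨s₀.2, h₀⟩).imp' (Prod.mk ()) fun _ h => h,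
      fun ⟨s₁, h₁⟩ => ((hσ s.2).both.2 ⟨s₁.2, h₁⟩).imp' (Prod.mk ()) fun _ h => h⟩
  · rintro T ⟨l, hl⟩
    have key : ∀ s : Unit × PTerm, Relation.ReflTransGen
        (fun s s' : Unit × PTerm => ∃ κ, σ s.2 κ s'.2) ((), M.emptyPrefix) s → s.2 ∈ F := by
      intro s hs
      induction hs with
      | refl => exact hM
      | tail _ h ih =>
        obtain ⟨κ, h⟩ := h
        exact (hσ _).mem _ _ h ih
    exact key (l, T) hl

theorem exists_strategy_iff (P : ProofSystem) (M : InfTerm) :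
    (∃ S : Strategy (DecompStep P.Vac), S.IsScopeDelimiting ∧ (S.generatedSubterms M).Finite) ↔
      ∃ F : Set PTerm, F.Finite ∧ M.emptyPrefix ∈ F ∧ P.UnfoldingClosed F := by
  constructor
  · rintro ⟨S, hS, hfin⟩
    exact exists_finite_unfoldingClosed_of_strategy S hS hfin
  · rintro ⟨F, hfin, hM, hF⟩
    obtain ⟨S, hS, hsub⟩ := exists_strategy_of_unfoldingClosed hF hM
    exact ⟨S, hS, hfin.subset hsub⟩

/-! ### Unfolding closed sets and derivations -/

theorem FixCondition.one_le_depth {P : ProofSystem} {u : ℕ} {D : ProofTree}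
    (h : P.FixCondition u D) : 1 ≤ D.depth := by
  cases P
  exacts [h, h, h.1]

/-- The formulas of a derivation unfold among themselves, except for those that occur as open
assumptions. That the conclusion of a derivation other than a leaf always unfolds makes the
induction work for `FIX`, where assumptions are discharged. -/
theorem IsDerivation.exists_finite_unfolds {P : ProofSystem} {D : ProofTree}
    (hD : P.IsDerivation D) :
    ∃ F : Set PTerm, F.Finite ∧ D.conclusion ∈ F ∧ (1 ≤ D.depth → P.Unfolds F D.conclusion) ∧
      ∀ T ∈ F, P.Unfolds F T ∨ ∃ u t, D.Thread u T t := by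
  -- the formulas of a derivation that ends with a rule other than `FIX`
  have hinsert {E : ProofTree} {F : Set PTerm} (hF : F.Finite) (hE : P.Unfolds F E.conclusion)
      (h : ∀ T ∈ F, P.Unfolds F T ∨ ∃ u t, E.Thread u T t) :
      ∃ F : Set PTerm, F.Finite ∧ E.conclusion ∈ F ∧ (1 ≤ E.depth → P.Unfolds F E.conclusion) ∧
        ∀ T ∈ F, P.Unfolds F T ∨ ∃ u t, E.Thread u T t := by
    have hE' : P.Unfolds (insert E.conclusion F) E.conclusion := hE.mono (Set.subset_insert _ _)
    refine ⟨_, hF.insert _, Set.mem_insert _ _, fun _ => hE', ?_⟩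
    rintro T (rfl | hT)
    · exact Or.inl hE'
    · exact (h T hT).imp_left (Unfolds.mono (Set.subset_insert _ _))
  induction hD with
  | assumption u T =>
    refine ⟨{T}, Set.finite_singleton T, rfl, fun h => absurd h (Nat.not_succ_le_zero 0), ?_⟩
    rintro _ rfl
    exact Or.inr ⟨u, _, .assumption⟩
  | nlvar h => exact hinsert Set.finite_empty (.nlvar h) fun _ => False.elim
  | lam h _ ih =>
    obtain ⟨F, hF, hc, -, hu⟩ := ih
    exact hinsert hF (.lam hc h) fun T hT =>
      (hu T hT).imp_right fun ⟨u, t, ht⟩ => ⟨u, _, .lam ht⟩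
  | vac h _ ih =>
    obtain ⟨F, hF, hc, -, hu⟩ := ih
    exact hinsert hF (.vac hc h) fun T hT =>
      (hu T hT).imp_right fun ⟨u, t, ht⟩ => ⟨u, _, .vac ht⟩
  | app h _ _ ih₀ ih₁ =>
    obtain ⟨F₀, hF₀, hc₀, -, hu₀⟩ := ih₀
    obtain ⟨F₁, hF₁, hc₁, -, hu₁⟩ := ih₁
    refine hinsert (hF₀.union hF₁) (.app (Or.inl hc₀) (Or.inr hc₁) h) ?_
    rintro T (hT | hT)
    · exact (hu₀ T hT).imp (Unfolds.mono Set.subset_union_left)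
        fun ⟨u, t, ht⟩ => ⟨u, _, .appLeft ht⟩
    · exact (hu₁ T hT).imp (Unfolds.mono Set.subset_union_right)
        fun ⟨u, t, ht⟩ => ⟨u, _, .appRight ht⟩
  | @fix v D h _ ih =>
    obtain ⟨F, hF, hc, hd, hu⟩ := ih
    refine ⟨F, hF, hc, fun _ => hd h.one_le_depth, fun T hT => ?_⟩
    obtain hT | ⟨u, t, ht⟩ := hu T hT
    · exact Or.inl hT
    · by_cases hdis : u = v ∧ T = D.conclusion
      · exact Or.inl (hdis.2 ▸ hd h.one_le_depth)
      · exact Or.inr ⟨u, _, .fix ht hdis⟩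

/-- `BoundedThreads A D`: all open assumptions of `D` have marker `0` and formula in `A`, and no
prefix on a thread is shorter than that of the assumption at its top. -/
def BoundedThreads (A : Finset PTerm) (D : ProofTree) : Prop :=
  ∀ u B t, D.Thread u B t → u = 0 ∧ B ∈ A ∧ ∀ S ∈ t, B.len ≤ S.len

/-- Adding an instance of `FIX` whose conclusion has a prefix at least as long as those of the other
open assumptions. Since `FIX` discharges only assumptions of its own formula, a single marker
suffices. -/
theorem BoundedThreads.fix {P : ProofSystem} {A : Finset PTerm} {D : ProofTree}
    [DecidableEq PTerm] (hD : P.IsDerivation D) (hdepth : 1 ≤ D.depth)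
    (h : BoundedThreads (insert D.conclusion (A.filter (PTerm.len · ≤ D.conclusion.len))) D) :
    P.IsDerivation (.fix 0 D) ∧ BoundedThreads A (.fix 0 D) := by
  refine ⟨.fix ?_ hD, ?_⟩
  · cases P
    exacts [hdepth, hdepth, ⟨hdepth, fun t ht => (h 0 _ t ht).2.2⟩]
  · intro u B t ht
    cases ht with
    | fix ht hdis =>
      obtain ⟨rfl, hB, hlen⟩ := h _ _ _ ht
      obtain rfl | hB := Finset.mem_insert.1 hB
      · exact absurd ⟨rfl, rfl⟩ hdis
      · obtain ⟨hBA, hBlen⟩ := Finset.mem_filter.1 hB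
        exact ⟨rfl, hBA, List.forall_mem_cons.2 ⟨hBlen, hlen⟩⟩

/-- Visiting a formula `T` that is not available as an assumption is a descent in the
Dershowitz–Manna order: `T` leaves the set of unavailable formulas, and only formulas with longer
prefixes enter it. Here `N` bounds the prefix lengths, to turn longer prefixes into smaller
numbers. -/
theorem isDershowitzMannaLT_sdiff [DecidableEq PTerm] {F A : Finset PTerm} {T : PTerm} {N : ℕ}
    (hN : ∀ S ∈ F, S.len ≤ N) (hT : T ∈ F) (hTA : T ∉ A) :
    Multiset.IsDershowitzMannaLT
      ((F \ insert T (A.filter (PTerm.len · ≤ T.len))).val.map fun S => N - S.len)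
      ((F \ A).val.map fun S => N - S.len) := by
  refine ⟨((F \ A).erase T).val.map fun S => N - S.len,
    ((F ∩ A).filter (T.len < PTerm.len ·)).val.map fun S => N - S.len, {N - T.len},
    Multiset.singleton_ne_zero _, ?_, ?_, ?_⟩
  · have hdisj : Disjoint ((F \ A).erase T) ((F ∩ A).filter (T.len < PTerm.len ·)) := by
      refine Finset.disjoint_left.2 fun S h₁ h₂ => ?_
      simp only [Finset.mem_erase, Finset.mem_sdiff, Finset.mem_filter, Finset.mem_inter] at h₁ h₂
      exact h₁.2.2 h₂.1.2
    rw [← Multiset.map_add, ← Finset.disjUnion_val _ _ hdisj]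
    congr 2
    ext S
    simp only [Finset.disjUnion_eq_union, Finset.mem_union, Finset.mem_erase, Finset.mem_sdiff,
      Finset.mem_filter, Finset.mem_inter, Finset.mem_insert, not_or, not_and, not_le]
    constructor
    · rintro ⟨hS, hne, hlt⟩
      by_cases hSA : S ∈ A
      · exact Or.inr ⟨⟨hS, hSA⟩, hlt hSA⟩
      · exact Or.inl ⟨hne, hS, hSA⟩
    · rintro (⟨hne, hS, hSA⟩ | ⟨⟨hS, hSA⟩, hlt⟩)
      · exact ⟨hS, hne, fun h => absurd h hSA⟩
      · exact ⟨hS, fun h => hTA (h ▸ hSA), fun _ => hlt⟩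
  · have hmem : T ∈ (F \ A).val := Finset.mem_sdiff.2 ⟨hT, hTA⟩
    rw [Finset.erase_val, ← Multiset.map_singleton (fun S : PTerm => N - S.len),
      ← Multiset.map_add, add_comm, Multiset.singleton_add, Multiset.cons_erase hmem]
  · intro y hy
    obtain ⟨S, hS, rfl⟩ := Multiset.mem_map.1 hy
    obtain ⟨hSF, hlt⟩ := Finset.mem_filter.1 hS
    have := hN S (Finset.mem_inter.1 hSF).1
    exact ⟨_, Multiset.mem_singleton_self _, by omega⟩

/-- The members of a finite unfolding closed set are derivable, with threads as in `Reg⁺₀`, from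
any set `A` of assumptions. -/
theorem exists_derivation_of_unfoldingClosed {P : ProofSystem} {F : Finset PTerm}
    (hF : P.UnfoldingClosed (F : Set PTerm)) (A : Finset PTerm) {T : PTerm} (hT : T ∈ F) :
    ∃ D, P.IsDerivation D ∧ BoundedThreads A D ∧ D.conclusion = T := by
  classical
  have hN (S : PTerm) (hS : S ∈ F) : S.len ≤ F.sup PTerm.len := Finset.le_sup hS
  induction hA : (F \ A).val.map fun S => F.sup PTerm.len - S.len using
    (Multiset.wellFounded_isDershowitzMannaLT (α := ℕ)).induction generalizing A T with
  | _ m ih =>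
  subst hA
  by_cases hTA : T ∈ A
  · refine ⟨.assumption 0 T, .assumption 0 T, ?_, rfl⟩
    intro u B t ht
    cases ht
    exact ⟨rfl, hTA, by simp⟩
  -- The formulas that stay available above `T`: those with longer prefixes are dropped, since a
  -- thread from them would pass through `T`.
  obtain ⟨A', hA'⟩ : ∃ A', A' = insert T (A.filter (PTerm.len · ≤ T.len)) := ⟨_, rfl⟩
  have hle {B : PTerm} (hB : B ∈ A') : B.len ≤ T.len := by
    rw [hA'] at hB
    obtain rfl | hB := Finset.mem_insert.1 hB
    exacts [le_rfl, (Finset.mem_filter.1 hB).2]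
  have hrec {T' : PTerm} (hT' : T' ∈ F) :
      ∃ D, P.IsDerivation D ∧ BoundedThreads A' D ∧ D.conclusion = T' := by
    refine ih _ ?_ A' hT' rfl
    rw [hA']
    exact isDershowitzMannaLT_sdiff hN hT hTA
  have hcons {D : ProofTree} (hD : BoundedThreads A' D) {u B t} (ht : D.Thread u B t) :
      u = 0 ∧ B ∈ A' ∧ ∀ S ∈ T :: t, B.len ≤ S.len := by
    obtain ⟨hu, hB, hlen⟩ := hD u B t ht
    exact ⟨hu, hB, List.forall_mem_cons.2 ⟨hle hB, hlen⟩⟩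
  have hfix {E : ProofTree} (hE : P.IsDerivation E) (hdepth : 1 ≤ E.depth) (hc : E.conclusion = T)
      (hb : BoundedThreads A' E) :
      ∃ D, P.IsDerivation D ∧ BoundedThreads A D ∧ D.conclusion = T := by
    subst hc
    obtain ⟨h₁, h₂⟩ := BoundedThreads.fix hE hdepth (hA' ▸ hb)
    exact ⟨_, h₁, h₂, rfl⟩
  cases hF T hT with
  | nlvar h =>
    refine ⟨.nlvar T, .nlvar h, ?_, rfl⟩
    intro u B t ht
    cases ht
  | lam hT' h =>
    obtain ⟨D, hD, hb, rfl⟩ := hrec hT'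
    refine hfix (.lam h hD) (Nat.le_add_left _ _) rfl ?_
    intro u B t ht
    cases ht with
    | lam ht => exact hcons hb ht
  | vac hT' h =>
    obtain ⟨D, hD, hb, rfl⟩ := hrec hT'
    refine hfix (.vac h hD) (Nat.le_add_left _ _) rfl ?_
    intro u B t ht
    cases ht with
    | vac ht => exact hcons hb ht
  | app hT₀ hT₁ h =>
    obtain ⟨D₀, hD₀, hb₀, rfl⟩ := hrec hT₀
    obtain ⟨D₁, hD₁, hb₁, rfl⟩ := hrec hT₁
    refine hfix (.app h hD₀ hD₁) (Nat.le_add_left _ _) rfl ?_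
    intro u B t ht
    cases ht with
    | appLeft ht => exact hcons hb₀ ht
    | appRight ht => exact hcons hb₁ ht

theorem provable_iff (P : ProofSystem) (T : PTerm) :
    P.Provable T ↔ ∃ F : Set PTerm, F.Finite ∧ T ∈ F ∧ P.UnfoldingClosed F := by
  constructor
  · rintro ⟨D, hD, hclosed, rfl⟩
    obtain ⟨F, hF, hc, -, hu⟩ := hD.exists_finite_unfolds
    exact ⟨F, hF, hc, fun T hT => (hu T hT).resolve_right fun ⟨u, t, ht⟩ => hclosed u T t ht⟩
  · rintro ⟨F, hfin, hT, hF⟩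
    lift F to Finset PTerm using hfin
    obtain ⟨D, hD, hb, rfl⟩ := exists_derivation_of_unfoldingClosed hF ∅ hT
    exact ⟨D, hD, fun u B t ht => absurd (hb u B t ht).2.1 (Finset.notMem_empty B), rfl⟩

theorem provable_iff_exists_strategy (P : ProofSystem) (M : InfTerm) :
    P.Provable M.emptyPrefix ↔
      ∃ S : Strategy (DecompStep P.Vac), S.IsScopeDelimiting ∧ (S.generatedSubterms M).Finite :=
  (P.provable_iff _).trans (P.exists_strategy_iff M).symm

end ProofSystem

end InfLambda

theorem mainTheorem1 :
    (∀ M : InfLambda.InfTerm,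
      InfLambda.ProofSystem.reg.Provable M.emptyPrefix ↔ InfLambda.Regular M) ∧
    (∀ M : InfLambda.InfTerm,
      List.TFAE
        [InfLambda.StronglyRegular M,
          InfLambda.ProofSystem.regPlus.Provable M.emptyPrefix,
          InfLambda.ProofSystem.regPlusZero.Provable M.emptyPrefix]) := by
  refine ⟨InfLambda.ProofSystem.reg.provable_iff_exists_strategy, fun M => ?_⟩
  -- `Reg⁺` and `Reg⁺₀` both have `VacLast` as their rule for vacuous bindings, so each is
  -- equivalent to strong regularity.
  tfae_have 2 ↔ 1 := InfLambda.ProofSystem.regPlus.provable_iff_exists_strategy M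
  tfae_have 3 ↔ 1 := InfLambda.ProofSystem.regPlusZero.provable_iff_exists_strategy M
  tfae_finish
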